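/- Consider propositional formulas built from countably many variables with the connectives $\wedge,\vee,\to,\bot,\top$. The implication depth $d(\varphi)$ is defined by $d(p)=d(\bot)=d(\top)=0$ for a variable $p$, $d(\varphi\wedge\psi)=d(\varphi\vee\psi)=\max(d(\varphi),d(\psi))$ and $d(\varphi\to\psi)=\max(d(\varphi),d(\psi))+1$. A superintuitionistic logic is a set $L$ of formulas that contains all theorems of the intuitionistic propositional calculus $\mathsf{IPC}$ and is closed under modus ponens and uniform substitution. Formulas $\varphi,\psi$ are equivalent over $L$ if $\varphi\leftrightarrow\psi\in L$. The logic $L$ is locally tabular if for every finite set of variables there are, up to equivalence over $L$, only finitely many formulas in these variables. It is $n$-uniform if every formula is equivalent over $L$ to a formula of implication depth at most $n$, and uniformly locally tabular if it is $n$-uniform for some $n\in\mathbb{N}$. Let $\mathsf{wPL}$ (the weak Peirce logic) be the least superintuitionistic logic that contains $$(q\to p)\vee\bigl(((p\to q)\to p)\to p\bigr).$$ Theorem. The logic $\mathsf{wPL}$ is locally tabular, but it is not uniformly locally tabular: for no $n$ is it $n$-uniform. In particular, local tabularity does not imply uniform local tabularity for superintuitionistic logics. -/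

import Mathlib

/-- Formulas of intuitionistic propositional logic in the signature `(∧, ∨, →, ⊥, ⊤)`, over the
countably many propositional variables `p₀, p₁, p₂, …`. -/
inductive Formula : Type
  | var : ℕ → Formula
  | bot : Formula
  | top : Formula
  | and : Formula → Formula → Formula
  | or : Formula → Formula → Formula
  | imp : Formula → Formula → Formula

namespace Formula

/-- The biconditional `φ ↔ ψ`, that is, `(φ → ψ) ∧ (ψ → φ)`. -/
def iff (φ ψ : Formula) : Formula := and (imp φ ψ) (imp ψ φ)

/-- The finite set of variables that occur in a formula. -/
def vars : Formula → Finset ℕ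
  | var i => {i}
  | bot => ∅
  | top => ∅
  | and φ ψ => φ.vars ∪ ψ.vars
  | or φ ψ => φ.vars ∪ ψ.vars
  | imp φ ψ => φ.vars ∪ ψ.vars

/-- The implication depth of a formula. -/
def depth : Formula → ℕ
  | var _ => 0
  | bot => 0
  | top => 0
  | and φ ψ => max φ.depth ψ.depth
  | or φ ψ => max φ.depth ψ.depth
  | imp φ ψ => max φ.depth ψ.depth + 1

/-- Uniform substitution of formulas for variables. -/
def subst (σ : ℕ → Formula) : Formula → Formula
  | var i => σ i
  | bot => bot
  | top => top
  | and φ ψ => and (φ.subst σ) (ψ.subst σ)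
  | or φ ψ => or (φ.subst σ) (ψ.subst σ)
  | imp φ ψ => imp (φ.subst σ) (ψ.subst σ)

end Formula

open Formula in
/-- Theorems of the intuitionistic propositional calculus `IPC`, by a Hilbert-style calculus with
axiom schemes and modus ponens. -/
inductive IPC : Formula → Prop
  | k (φ ψ : Formula) : IPC (imp φ (imp ψ φ))
  | s (φ ψ χ : Formula) :
      IPC (imp (imp φ (imp ψ χ)) (imp (imp φ ψ) (imp φ χ)))
  | and_left (φ ψ : Formula) : IPC (imp (and φ ψ) φ)
  | and_right (φ ψ : Formula) : IPC (imp (and φ ψ) ψ)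
  | and_intro (φ ψ : Formula) : IPC (imp φ (imp ψ (and φ ψ)))
  | or_left (φ ψ : Formula) : IPC (imp φ (or φ ψ))
  | or_right (φ ψ : Formula) : IPC (imp ψ (or φ ψ))
  | or_elim (φ ψ χ : Formula) :
      IPC (imp (imp φ χ) (imp (imp ψ χ) (imp (or φ ψ) χ)))
  | bot_elim (φ : Formula) : IPC (imp bot φ)
  | top_intro : IPC top
  | mp {φ ψ : Formula} : IPC (imp φ ψ) → IPC φ → IPC ψ

/-- A superintuitionistic logic: a set of formulas that contains every theorem of `IPC` and is
closed under modus ponens and uniform substitution. -/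
structure SuperintuitionisticLogic where
  carrier : Set Formula
  ipc_subset : ∀ φ, IPC φ → φ ∈ carrier
  mp_mem : ∀ φ ψ, Formula.imp φ ψ ∈ carrier → φ ∈ carrier → ψ ∈ carrier
  subst_mem : ∀ (σ : ℕ → Formula) (φ : Formula), φ ∈ carrier → φ.subst σ ∈ carrier

namespace SuperintuitionisticLogic

/-- `φ` is a theorem of `L`. -/
def Proves (L : SuperintuitionisticLogic) (φ : Formula) : Prop := φ ∈ L.carrier

/-- `IPC ⊕ α`: the least superintuitionistic logic that contains the formula `α`. -/
def oplus (α : Formula) : SuperintuitionisticLogic where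
  carrier := {φ | ∀ L : SuperintuitionisticLogic, L.Proves α → L.Proves φ}
  ipc_subset φ h L _ := L.ipc_subset φ h
  mp_mem φ ψ h₁ h₂ L hL := L.mp_mem φ ψ (h₁ L hL) (h₂ L hL)
  subst_mem σ φ h L hL := L.subst_mem σ φ (h L hL)

/-- `φ` and `ψ` are equivalent over `L`. -/
def Equivalent (L : SuperintuitionisticLogic) (φ ψ : Formula) : Prop :=
  L.Proves (Formula.iff φ ψ)

/-- `L` is locally tabular: for each finite set `s` of variables there are only finitely many
formulas over `s` up to equivalence over `L`. -/
def LocallyTabular (L : SuperintuitionisticLogic) : Prop :=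
  ∀ s : Finset ℕ, ∃ T : Set Formula, T.Finite ∧ (∀ ψ ∈ T, ψ.vars ⊆ s) ∧
    ∀ φ : Formula, φ.vars ⊆ s → ∃ ψ ∈ T, L.Equivalent φ ψ

/-- `L` is `n`-uniform: each formula is equivalent over `L` to a formula of implication depth at
most `n`. -/
def Uniform (L : SuperintuitionisticLogic) (n : ℕ) : Prop :=
  ∀ φ : Formula, ∃ ψ : Formula, ψ.depth ≤ n ∧ L.Equivalent φ ψ

/-- `L` is uniformly locally tabular: it is `n`-uniform for some `n`. -/
def UniformlyLocallyTabular (L : SuperintuitionisticLogic) : Prop :=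
  ∃ n : ℕ, L.Uniform n

/-- The weak Peirce formula `(q → p) ∨ (((p → q) → p) → p)`, with `p = p₀` and `q = p₁`. -/
def weakPeirce : Formula :=
  Formula.or (Formula.imp (Formula.var 1) (Formula.var 0))
    (Formula.imp
      (Formula.imp (Formula.imp (Formula.var 0) (Formula.var 1)) (Formula.var 0))
      (Formula.var 0))

/-- The weak Peirce logic `wPL = IPC ⊕ (q → p) ∨ (((p → q) → p) → p)`. -/
def wPL : SuperintuitionisticLogic := oplus weakPeirce

end SuperintuitionisticLogic

/-! Uniformity fails because of one frame, an infinite descending stack of two-point antichains,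
which validates weak Peirce. If `pᵢ` cuts layer `i` in half, a formula of depth at most `n` cannot
separate `(j, false)` from `(j + 1, true)` for `j ≥ n`
(`Formula.forces_false_iff_forces_succ_true`), yet `pₙ → layersBelow n` separates them at `j = n`.

For local tabularity, pass to Lindenbaum algebras of prime theories, where the axiom reads: `b ≤ a`
or `(a ⇨ b) ⇨ a ≤ a`. Such an algebra is a stack of blocks separated by nodes. Every non-node has a
least node above it; elements with the same least node have complements relative to each other; and
`a ⇨ b = b` when `b ≤ a` lies outside the block of `a`. Thus implication is Boolean inside a block
and trivial across blocks, and `n` elements lie in a finite subalgebra of size bounded in `n` alone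
(`WeakPeirceLaw.exists_finset_closed`). Because the bound is uniform, finitely many interpretations
on one finite set decide equivalence over `wPL`. -/

/-! ### The layered frame and failure of uniformity -/

/-- Forcing in the frame `ℕ × Bool` of stacked two-element antichains; the layer of index `0` is the
topmost one. -/
def Formula.Forces (V : ℕ → ℕ × Bool → Prop) : Formula → ℕ × Bool → Prop
  | .var i, u => V i u
  | .bot, _ => False
  | .top, _ => True
  | .and φ ψ, u => φ.Forces V u ∧ ψ.Forces V u
  | .or φ ψ, u => φ.Forces V u ∨ ψ.Forces V u
  | .imp φ ψ, u => ∀ w, (w = u ∨ w.1 < u.1) → φ.Forces V w → ψ.Forces V w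

/-- Valuations of the variables by upsets of the layered frame. -/
def PersistentValuation (V : ℕ → ℕ × Bool → Prop) : Prop :=
  ∀ i u w, w.1 < u.1 → V i u → V i w

theorem Formula.Forces.mono {V : ℕ → ℕ × Bool → Prop} (hV : PersistentValuation V)
    {φ : Formula} {u w : ℕ × Bool} (huw : w = u ∨ w.1 < u.1) (h : φ.Forces V u) :
    φ.Forces V w := by
  induction φ with
  | var i =>
    rcases huw with rfl | huw
    · exact h
    · exact hV i u w huw h
  | bot => exact h
  | top => trivial
  | and φ ψ ih₁ ih₂ => exact ⟨ih₁ h.1, ih₂ h.2⟩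
  | or φ ψ ih₁ ih₂ => exact h.imp ih₁ ih₂
  | imp φ ψ _ _ =>
    intro x hx
    apply h x
    rcases hx with rfl | hx
    · exact huw
    · rcases huw with rfl | huw
      · exact Or.inr hx
      · exact Or.inr (hx.trans huw)

theorem IPC.forces {V : ℕ → ℕ × Bool → Prop} (hV : PersistentValuation V) {φ : Formula}
    (h : IPC φ) (u : ℕ × Bool) : φ.Forces V u := by
  have trans : ∀ {x w u : ℕ × Bool}, (x = w ∨ x.1 < w.1) → (w = u ∨ w.1 < u.1) →
      (x = u ∨ x.1 < u.1) := by
    rintro x w u (rfl | h₁) (rfl | h₂)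
    · exact Or.inl rfl
    · exact Or.inr h₂
    · exact Or.inr h₁
    · exact Or.inr (h₁.trans h₂)
  induction h generalizing u with
  | k φ ψ => exact fun w _ hφ x hx _ => hφ.mono hV hx
  | s φ ψ χ =>
    exact fun w _ h₁ x hx h₂ y hy hφ => h₁ y (trans hy hx) hφ y (Or.inl rfl) (h₂ y hy hφ)
  | and_left φ ψ => exact fun _ _ h => h.1
  | and_right φ ψ => exact fun _ _ h => h.2
  | and_intro φ ψ => exact fun w _ hφ x hx hψ => ⟨hφ.mono hV hx, hψ⟩
  | or_left φ ψ => exact fun _ _ h => Or.inl h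
  | or_right φ ψ => exact fun _ _ h => Or.inr h
  | or_elim φ ψ χ =>
    exact fun w _ h₁ x hx h₂ y hy h => h.elim (h₁ y (trans hy hx)) (h₂ y hy)
  | bot_elim φ => exact fun _ _ h => h.elim
  | top_intro => trivial
  | mp _ _ ih₁ ih₂ => exact ih₁ u u (Or.inl rfl) (ih₂ u)

theorem Formula.forces_subst (V : ℕ → ℕ × Bool → Prop) (σ : ℕ → Formula) (φ : Formula) :
    (φ.subst σ).Forces V = φ.Forces (fun i => (σ i).Forces V) := by
  induction φ with
  | var i => rfl
  | bot => rfl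
  | top => rfl
  | and φ ψ ih₁ ih₂ => simp only [subst, Forces, ih₁, ih₂]
  | or φ ψ ih₁ ih₂ => simp only [subst, Forces, ih₁, ih₂]
  | imp φ ψ ih₁ ih₂ => simp only [subst, Forces, ih₁, ih₂]

/-- The logic of the layered frame. -/
def layeredLogic : SuperintuitionisticLogic where
  carrier := {φ | ∀ V, PersistentValuation V → ∀ u, φ.Forces V u}
  ipc_subset _ h _ hV u := h.forces hV u
  mp_mem _ _ h₁ h₂ V hV u := h₁ V hV u u (Or.inl rfl) (h₂ V hV u)
  subst_mem σ φ h V hV u := by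
    rw [Formula.forces_subst]
    exact h _ (fun i _ _ huw hu => hu.mono hV (Or.inr huw)) u

/-- A countermodel needs `x` forcing `q` but not `p`, and `y` refuting the Peirce disjunct. If `x`
is in a higher layer than `y`, then `p → q` holds at `x`, which forces `p` there; otherwise `q`
holds in all layers above `y`, so `p → q` holds at `y`. -/
theorem layeredLogic_proves_weakPeirce :
    layeredLogic.Proves SuperintuitionisticLogic.weakPeirce := by
  intro V hV u
  by_contra hcon
  simp only [SuperintuitionisticLogic.weakPeirce, Formula.Forces, not_or, not_forall] at hcon
  obtain ⟨⟨x, -, hqx, hpx⟩, y, -, hy, hpy⟩ := hcon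
  refine hpy (hy y (Or.inl rfl) fun z hz hpz => ?_)
  rcases hz with rfl | hz
  · exact absurd hpz hpy
  rcases lt_or_ge x.1 y.1 with hxy | hxy
  · refine absurd (hy x (Or.inr hxy) fun w hw _ => ?_) hpx
    rcases hw with rfl | hw
    · exact hqx
    · exact hV _ _ _ hw hqx
  · exact hV _ _ _ (hz.trans_le hxy) hqx

theorem layeredLogic_proves_of_wPL {φ : Formula} (h : SuperintuitionisticLogic.wPL.Proves φ) :
    layeredLogic.Proves φ :=
  h layeredLogic layeredLogic_proves_weakPeirce

/-- The valuation that makes `pᵢ` true in the layers above layer `i` and at one point of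
layer `i`. -/
def halfLayerValuation (i : ℕ) (u : ℕ × Bool) : Prop := u.1 < i ∨ u = (i, true)

theorem persistentValuation_halfLayerValuation : PersistentValuation halfLayerValuation := by
  rintro i u w huw (h | rfl)
  · exact Or.inl (huw.trans h)
  · exact Or.inl huw

/-- The lower point sees only two points that the upper one does not: itself and the upper point's
twin. For an implication, both are handled by the induction hypothesis for the subformulas; the twin
needs it one layer higher, which is what the drop in depth pays for. -/
theorem Formula.forces_false_iff_forces_succ_true {φ : Formula} {n j : ℕ} (hφ : φ.depth ≤ n)
    (hj : n ≤ j) :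
    φ.Forces halfLayerValuation (j, false) ↔ φ.Forces halfLayerValuation (j + 1, true) := by
  refine ⟨?_, fun h => h.mono persistentValuation_halfLayerValuation (Or.inr (Nat.lt_succ_self j))⟩
  induction φ generalizing n j with
  | var i =>
    simp only [Forces, halfLayerValuation, Prod.mk.injEq]
    simp only [Bool.false_eq_true, and_false, or_false, and_true]
    omega
  | bot => exact id
  | top => exact id
  | and φ ψ ih₁ ih₂ =>
    simp only [depth, max_le_iff] at hφ
    exact And.imp (ih₁ hφ.1 hj) (ih₂ hφ.2 hj)
  | or φ ψ ih₁ ih₂ =>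
    simp only [depth, max_le_iff] at hφ
    exact Or.imp (ih₁ hφ.1 hj) (ih₂ hφ.2 hj)
  | imp φ ψ ih₁ ih₂ =>
    have hmono := @Forces.mono _ persistentValuation_halfLayerValuation
    simp only [depth] at hφ
    obtain ⟨n, rfl⟩ : ∃ m, n = m + 1 := ⟨n - 1, by omega⟩
    obtain ⟨j, rfl⟩ : ∃ m, j = m + 1 := ⟨j - 1, by omega⟩
    have hdepth : φ.depth ≤ n ∧ ψ.depth ≤ n := by omega
    intro h w hw hφw
    have key : φ.Forces halfLayerValuation (j + 1, false) →
        ψ.Forces halfLayerValuation (j + 1, false) := h _ (Or.inl rfl)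
    rcases hw with rfl | hw
    · exact ih₂ hdepth.2 (by omega) (key (hmono (Or.inr (by simp)) hφw))
    · obtain ⟨i, b⟩ := w
      simp only at hw
      rcases Nat.lt_or_ge i (j + 1) with hi | hi
      · exact h _ (Or.inr hi) hφw
      obtain rfl : i = j + 1 := by omega
      cases b
      · exact key hφw
      · exact ih₂ hdepth.2 (by omega)
          (h _ (Or.inr (Nat.lt_succ_self j)) (hmono (Or.inr (Nat.lt_succ_self j)) hφw))

/-- A formula that defines the union of the layers of index less than `j`. -/
def layersBelow : ℕ → Formula
  | 0 => .bot
  | j + 1 => .or (.var j) (.imp (.var j) (layersBelow j))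

/-- The disjunct `pⱼ` captures `(j, true)` and the implication captures `(j, false)`; every point of
a lower layer sees `(j, true)` and refutes both. -/
theorem forces_layersBelow (j : ℕ) (u : ℕ × Bool) :
    (layersBelow j).Forces halfLayerValuation u ↔ u.1 < j := by
  induction j generalizing u with
  | zero => simp [layersBelow, Formula.Forces]
  | succ j ih =>
    simp only [layersBelow, Formula.Forces, ih, halfLayerValuation]
    constructor
    · rintro ((h | rfl) | h)
      · omega
      · simp
      · by_contra hu
        simpa using h (j, true) (Or.inr (by simp; omega)) (Or.inr rfl)
    · intro h
      rcases Nat.lt_succ_iff_lt_or_eq.1 h with h | h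
      · exact Or.inl (Or.inl h)
      · obtain ⟨i, b⟩ := u
        obtain rfl : i = j := h
        cases b
        · right
          rintro w (rfl | hw) (h | h)
          · exact h
          · simp at h
          · exact h
          · exact hw
        · exact Or.inl (Or.inr rfl)

theorem not_uniform_wPL (n : ℕ) : ¬ SuperintuitionisticLogic.wPL.Uniform n := by
  intro h
  -- This formula fails exactly at points that see `(n, true)`: `(n + 1, true)` does, `(n, false)`
  -- does not.
  obtain ⟨ψ, hψ, heq⟩ := h (.imp (.var n) (layersBelow n))
  have heq' := fun u => layeredLogic_proves_of_wPL heq halfLayerValuation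
    persistentValuation_halfLayerValuation u
  have h₁ : (Formula.imp (.var n) (layersBelow n)).Forces halfLayerValuation (n, false) := by
    intro w hw hp
    rw [forces_layersBelow]
    rcases hp with hp | rfl
    · exact hp
    · simp at hw
  have h₂ := (Formula.forces_false_iff_forces_succ_true hψ le_rfl).1
    ((heq' (n, false)).1 _ (Or.inl rfl) h₁)
  have h₃ := (heq' (n + 1, true)).2 _ (Or.inl rfl) h₂ (n, true) (Or.inr (by simp))
    (Or.inr rfl)
  rw [forces_layersBelow] at h₃
  exact lt_irrefl _ h₃

/-! ### Finite relative Boolean lattices -/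

/-- A finite family of relatively complemented elements of an interval of a distributive lattice is
contained in a finite Boolean sublattice of the interval, of size bounded in that of the family. -/
theorem exists_finset_relative_boolean (n : ℕ) : ∃ N : ℕ, ∀ {α : Type} [DistribLattice α] {m t : α},
    m ≤ t → ∀ F : Finset α, F.card ≤ n → (∀ x ∈ F, ∃ z, x ⊓ z = m ∧ x ⊔ z = t) →
    ∃ E : Finset α, E.card ≤ N ∧ F ⊆ E ∧ m ∈ E ∧ t ∈ E ∧
      (∀ x ∈ E, ∀ y ∈ E, x ⊓ y ∈ E ∧ x ⊔ y ∈ E) ∧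
      ∀ x ∈ E, ∃ z ∈ E, x ⊓ z = m ∧ x ⊔ z = t := by
  classical
  induction n with
  | zero =>
    refine ⟨2, fun {α _ m t} hmt F hF _ => ⟨{m, t}, Finset.card_le_two, ?_, by simp, by simp, ?_, ?_⟩⟩
    · simp [Finset.card_eq_zero.1 (Nat.le_zero.1 hF)]
    · simp [hmt]
    · simp [hmt]
  | succ n ih =>
    obtain ⟨N, hN⟩ := ih
    -- The summand `N` covers the case of an empty family.
    refine ⟨N * N + N, fun {α _ m t} hmt F hF hcompl => ?_⟩
    rcases F.eq_empty_or_nonempty with rfl | ⟨x, hx⟩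
    · obtain ⟨E, hE, h⟩ := hN hmt ∅ (by simp) (by simp)
      exact ⟨E, hE.trans (Nat.le_add_left _ _), h⟩
    obtain ⟨E, hE, hFE, hm, ht, hcl, hc⟩ := hN hmt (F.erase x)
      (by rw [Finset.card_erase_of_mem hx]; omega)
      (fun y hy => hcompl y (Finset.mem_of_mem_erase hy))
    obtain ⟨z, hxz, hxz'⟩ := hcompl x hx
    have hmx : m ≤ x := hxz ▸ inf_le_left
    have hmz : m ≤ z := hxz ▸ inf_le_right
    have hxt : x ≤ t := hxz' ▸ le_sup_left
    have hzt : z ≤ t := hxz' ▸ le_sup_right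
    have hE_mem : ∀ y ∈ E, m ≤ y ∧ y ≤ t := by
      intro y hy
      obtain ⟨w, -, h₁, h₂⟩ := hc y hy
      exact ⟨h₁ ▸ inf_le_left, h₂ ▸ le_sup_left⟩
    have inf_x : ∀ e ∈ E, ∀ f ∈ E, (e ⊓ x ⊔ f ⊓ z) ⊓ x = e ⊓ x := by
      intro e he f hf
      rw [inf_sup_right, inf_assoc, inf_idem, inf_assoc, inf_comm z x, hxz,
        inf_eq_right.2 (hE_mem f hf).1]
      exact sup_eq_left.2 (le_inf (hE_mem e he).1 hmx)
    have inf_z : ∀ e ∈ E, ∀ f ∈ E, (e ⊓ x ⊔ f ⊓ z) ⊓ z = f ⊓ z := by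
      intro e he f hf
      rw [inf_sup_right, inf_assoc, inf_assoc, inf_idem, hxz,
        inf_eq_right.2 (hE_mem e he).1]
      exact sup_eq_right.2 (le_inf (hE_mem f hf).1 hmz)
    have split : ∀ y, y ≤ t → y = y ⊓ x ⊔ y ⊓ z := by
      intro y hy
      rw [← inf_sup_left, hxz', inf_eq_left.2 hy]
    -- The pair `x`, `z` splits the interval into a product via `y ↦ (y ⊓ x, y ⊓ z)`; `E'` consists
    -- of the elements with both coordinates coming from `E`, so all operations are coordinatewise.
    set E' := (E ×ˢ E).image fun p => p.1 ⊓ x ⊔ p.2 ⊓ z with hE'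
    have mem : ∀ y, y ∈ E' ↔ y ≤ t ∧ (∃ e ∈ E, y ⊓ x = e ⊓ x) ∧ ∃ f ∈ E, y ⊓ z = f ⊓ z := by
      intro y
      simp only [hE', Finset.mem_image, Finset.mem_product, Prod.exists]
      constructor
      · rintro ⟨e, f, ⟨he, hf⟩, rfl⟩
        exact ⟨sup_le (inf_le_right.trans hxt) (inf_le_right.trans hzt),
          ⟨e, he, inf_x e he f hf⟩, f, hf, inf_z e he f hf⟩
      · rintro ⟨hy, ⟨e, he, h₁⟩, f, hf, h₂⟩
        exact ⟨e, f, ⟨he, hf⟩, by rw [← h₁, ← h₂, ← split y hy]⟩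
    have hEE' : ∀ y ∈ E, y ∈ E' := fun y hy =>
      (mem y).2 ⟨(hE_mem y hy).2, ⟨y, hy, rfl⟩, y, hy, rfl⟩
    refine ⟨E', ?_, ?_, hEE' m hm, hEE' t ht, ?_, ?_⟩
    · calc E'.card ≤ (E ×ˢ E).card := Finset.card_image_le
        _ = E.card * E.card := Finset.card_product _ _
        _ ≤ N * N + N := (Nat.mul_le_mul hE hE).trans (Nat.le_add_right _ _)
    · intro y hy
      by_cases hyx : y = x
      · subst hyx
        refine (mem y).2 ⟨hxt, ⟨t, ht, ?_⟩, m, hm, ?_⟩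
        · rw [inf_idem, inf_eq_right.2 hxt]
        · rw [hxz, inf_eq_left.2 hmz]
      · exact hEE' y (hFE (Finset.mem_erase.2 ⟨hyx, hy⟩))
    · intro y hy y' hy'
      obtain ⟨hyt, ⟨e, he, h₁⟩, f, hf, h₂⟩ := (mem y).1 hy
      obtain ⟨hyt', ⟨e', he', h₁'⟩, f', hf', h₂'⟩ := (mem y').1 hy'
      constructor
      · refine (mem _).2 ⟨inf_le_left.trans hyt, ⟨e ⊓ e', (hcl e he e' he').1, ?_⟩,
          f ⊓ f', (hcl f hf f' hf').1, ?_⟩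
        · rw [inf_inf_distrib_right, h₁, h₁', ← inf_inf_distrib_right]
        · rw [inf_inf_distrib_right, h₂, h₂', ← inf_inf_distrib_right]
      · refine (mem _).2 ⟨sup_le hyt hyt', ⟨e ⊔ e', (hcl e he e' he').2, ?_⟩,
          f ⊔ f', (hcl f hf f' hf').2, ?_⟩
        · rw [inf_sup_right, h₁, h₁', ← inf_sup_right]
        · rw [inf_sup_right, h₂, h₂', ← inf_sup_right]
    · intro y hy
      obtain ⟨hyt, ⟨e, he, h₁⟩, f, hf, h₂⟩ := (mem y).1 hy
      obtain ⟨e', he', hee, hee'⟩ := hc e he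
      obtain ⟨f', hf', hff, hff'⟩ := hc f hf
      have hx' := inf_x e' he' f' hf'
      have hz' := inf_z e' he' f' hf'
      have hw : e' ⊓ x ⊔ f' ⊓ z ≤ t := sup_le (inf_le_right.trans hxt) (inf_le_right.trans hzt)
      generalize e' ⊓ x ⊔ f' ⊓ z = w at hx' hz' hw
      refine ⟨w, (mem w).2 ⟨hw, ⟨e', he', hx'⟩, f', hf', hz'⟩, ?_, ?_⟩
      · rw [split (y ⊓ w) (inf_le_left.trans hyt), inf_inf_distrib_right y w x,
          inf_inf_distrib_right y w z, h₁, h₂, hx', hz', ← inf_inf_distrib_right, ← inf_inf_distrib_right, hee, hff,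
          inf_eq_left.2 hmx, inf_eq_left.2 hmz, sup_idem]
      · rw [split (y ⊔ w) (sup_le hyt hw), inf_sup_right, inf_sup_right, h₁, h₂, hx', hz',
          ← inf_sup_right, ← inf_sup_right, hee', hff', inf_eq_right.2 hxt, inf_eq_right.2 hzt,
          hxz']

/-! ### Nodes and blocks under the weak Peirce law -/

section WeakPeirceLaw

/-- The weak Peirce law in the form that it takes in a Heyting algebra with join-prime `⊤`. -/
def WeakPeirceLaw (B : Type*) [HeytingAlgebra B] : Prop :=
  ∀ a b : B, b ≤ a ∨ (a ⇨ b) ⇨ a ≤ a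

/-- A node of a partial order: an element that is comparable to every element. -/
def IsNode {B : Type*} [LE B] (t : B) : Prop := ∀ x : B, x ≤ t ∨ t ≤ x

/-- `IsCap t x`: the element `x` is not a node, and `t` is the least node above it. -/
def IsCap {B : Type*} [LE B] (t x : B) : Prop := ¬ IsNode x ∧ IsLeast {s | IsNode s ∧ x ≤ s} t

/-- The block below a node `t`: finite meets of elements that have `t` as their least node. -/
inductive InBlock {B : Type*} [SemilatticeInf B] (t : B) : B → Prop
  | of_isCap {x : B} : IsCap t x → InBlock t x
  | inf {x y : B} : InBlock t x → InBlock t y → InBlock t (x ⊓ y)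

variable {B : Type*} [HeytingAlgebra B] {a b s t x y : B}

theorem IsCap.unique (h₁ : IsCap s x) (h₂ : IsCap t x) : s = t := h₁.2.unique h₂.2

theorem InBlock.exists_isCap (h : InBlock t a) : ∃ x, IsCap t x := by
  induction h with
  | of_isCap h => exact ⟨_, h⟩
  | inf _ _ ih _ => exact ih

theorem InBlock.isNode (h : InBlock t a) : IsNode t := by
  obtain ⟨x, hx⟩ := h.exists_isCap
  exact hx.2.1.1

theorem InBlock.le (h : InBlock t a) : a ≤ t := by
  induction h with
  | of_isCap h => exact h.2.1.2
  | inf _ _ ih _ => exact inf_le_left.trans ih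

theorem InBlock.node_le (h : InBlock t a) (hs : IsNode s) (hst : ¬ t ≤ s) : s ≤ a := by
  induction h with
  | of_isCap h =>
    rename_i x
    exact (hs x).resolve_left fun hx => hst (h.2.2 ⟨hs, hx⟩)
  | inf _ _ ih₁ ih₂ => exact le_inf ih₁ ih₂

theorem InBlock.eq_of_isCap (h : InBlock t a) (h' : IsCap s a) : t = s := by
  by_contra hne
  have hst : s ≤ t := h'.2.2 ⟨h.isNode, h.le⟩
  have hsa : s ≤ a := h.node_le h'.2.1.1 fun hts => hne (le_antisymm hts hst)
  exact h'.1 (le_antisymm hsa h'.2.1.2 ▸ h'.2.1.1)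

namespace WeakPeirceLaw

variable (hW : WeakPeirceLaw B)

include hW

theorem himp_himp_eq (h : ¬ b ≤ a) : (a ⇨ b) ⇨ a = a :=
  le_antisymm ((hW a b).resolve_left h) le_himp

/-- With `t = a ⊔ c`, both `a` and `c` are fixed by `t ⇨ ·`. If `x` is incomparable to `t`, the law
for `t ⊓ x` and such a fixed `q ≤ t` leaves only `q ≤ x`; hence `t ≤ x`. -/
theorem isNode_sup_himp (h : ¬ b ≤ a) : IsNode (a ⊔ (a ⇨ b)) := by
  intro x
  by_contra! hcon
  obtain ⟨hx, ht⟩ := hcon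
  have hca := hW.himp_himp_eq h
  set c := a ⇨ b with hc
  have key : ∀ q, q ≤ a ⊔ c → x ⊓ (a ⊔ c ⇨ q) ≤ q → q ≤ x := by
    intro q hq hxq
    rcases hW ((a ⊔ c) ⊓ x) q with h' | h'
    · exact h'.trans inf_le_right
    · suffices x ≤ ((a ⊔ c) ⊓ x ⇨ q) ⇨ (a ⊔ c) ⊓ x from
        absurd (this.trans (h'.trans inf_le_left)) hx
      rw [le_himp_iff]
      refine le_inf (le_trans ?_ hq) inf_le_left
      refine le_trans ?_ hxq
      refine le_inf inf_le_left ?_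
      rw [le_himp_iff]
      calc x ⊓ ((a ⊔ c) ⊓ x ⇨ q) ⊓ (a ⊔ c) = (a ⊔ c) ⊓ x ⊓ ((a ⊔ c) ⊓ x ⇨ q) := by ac_rfl
        _ ≤ q := inf_himp_le
  refine ht (sup_le (key a le_sup_left ?_) (key c le_sup_right ?_))
  · rw [sup_himp_distrib, hca]
    exact inf_le_right.trans inf_le_right
  · rw [sup_himp_distrib, hc, himp_idem]
    exact inf_le_right.trans inf_le_left

theorem isCap_sup_himp (h₁ : ¬ y ≤ x) (h₂ : ¬ x ≤ y) : IsCap (x ⊔ (x ⇨ y)) x := by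
  refine ⟨fun h => (h y).elim h₁ h₂, ⟨hW.isNode_sup_himp h₁, le_sup_left⟩, ?_⟩
  rintro s ⟨hs, hxs⟩
  refine sup_le hxs ((hs _).resolve_right fun h => h₂ ?_)
  have := hxs.trans h
  rwa [le_himp_iff, inf_idem] at this

theorem exists_isCap (h : ¬ IsNode x) : ∃ t, IsCap t x := by
  simp only [IsNode, not_forall, not_or] at h
  obtain ⟨y, h₁, h₂⟩ := h
  exact ⟨_, hW.isCap_sup_himp h₁ h₂⟩

/-- Usually the right side is itself a node above `x`. The remaining case is `y ≤ x` with `x ⇨ y =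
y`: there the law pushes the whole cap of `y` below `x`, making `x` a node. -/
theorem le_sup_himp_of_isCap (hx : IsCap t x) (hy : IsCap t y) : t ≤ x ⊔ (x ⇨ y) := by
  by_cases hxy : x ≤ y
  · simp [himp_eq_top_iff.2 hxy]
  by_cases hyx : y ≤ x
  swap
  · exact hx.2.2 ⟨hW.isNode_sup_himp hyx, le_sup_left⟩
  by_cases hc : x ⇨ y ≤ y
  swap
  · have h₁ : ¬ (x ⇨ y) ≤ x := fun h => hc ((le_inf le_rfl h).trans himp_inf_le)
    have := hW.isNode_sup_himp h₁
    rw [himp_idem] at this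
    exact hx.2.2 ⟨this, le_sup_left⟩
  exfalso
  have hc : x ⇨ y = y := le_antisymm hc le_himp
  have hynode := hy.1
  simp only [IsNode, not_forall, not_or] at hynode
  obtain ⟨z, hzy, hyz⟩ := hynode
  have hcap := hW.isCap_sup_himp hzy hyz
  have hy' : (y ⇨ z) ⇨ y = y := hW.himp_himp_eq hzy
  have hyy' : ¬ y ≤ y ⇨ z := fun h => hyz (by rwa [le_himp_iff, inf_idem] at h)
  have hle : y ⇨ z ≤ x := by
    rcases hW ((y ⇨ z) ⊓ x) y with h | h
    · exact absurd (h.trans inf_le_left) hyy'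
    · rw [← himp_himp, hc, hy', himp_inf_distrib, himp_idem, himp_eq_top_iff.2 hyx,
        inf_top_eq] at h
      exact h.trans inf_le_right
  have hcap_le : y ⊔ (y ⇨ z) ≤ x := sup_le hyx hle
  rw [hcap.unique hy] at hcap_le
  exact hx.1 (le_antisymm hcap_le hx.2.1.2 ▸ hx.2.1.1)

theorem le_sup_himp_of_inBlock (ha : InBlock t a) (hb : InBlock t b) : t ≤ a ⊔ (a ⇨ b) := by
  induction hb with
  | of_isCap hb =>
    induction ha with
    | of_isCap ha => exact hW.le_sup_himp_of_isCap ha hb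
    | inf _ _ ih₁ ih₂ =>
      rw [sup_inf_right]
      exact le_inf (ih₁.trans (sup_le_sup_left (himp_le_himp_right inf_le_left) _))
        (ih₂.trans (sup_le_sup_left (himp_le_himp_right inf_le_right) _))
  | inf _ _ ih₁ ih₂ =>
    rw [himp_inf_distrib, sup_inf_left]
    exact le_inf ih₁ ih₂

/-- Here `a` and `a ⇨ b` are incomparable, share the cap `a ⊔ (a ⇨ b)`, and meet in `b`. -/
theorem exists_isCap_of_himp_ne (hba : b ≤ a) (hab : ¬ a ≤ b) (h : a ⇨ b ≠ b) :
    ∃ t, IsCap t a ∧ InBlock t b := by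
  have h₁ : ¬ a ⇨ b ≤ a := fun hc =>
    h (le_antisymm ((le_inf le_rfl hc).trans himp_inf_le) le_himp)
  have h₂ : ¬ a ≤ a ⇨ b := fun hc => hab (by rwa [le_himp_iff, inf_idem] at hc)
  have ha := hW.isCap_sup_himp h₁ h₂
  have hc := hW.isCap_sup_himp h₂ h₁
  have hca := hW.himp_himp_eq h₁
  rw [himp_idem] at ha hca
  rw [hca, sup_comm] at hc
  refine ⟨_, ha, ?_⟩
  have := InBlock.inf (.of_isCap ha) (.of_isCap hc)
  rwa [inf_himp, inf_eq_right.2 hba] at this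

theorem himp_eq_of_isNode (ha : IsNode a) (hba : b ≤ a) (hab : ¬ a ≤ b) : a ⇨ b = b := by
  by_contra h
  obtain ⟨t, ht, -⟩ := hW.exists_isCap_of_himp_ne hba hab h
  exact ht.1 ha

theorem himp_eq_of_not_inBlock (ha : InBlock t a) (hba : b ≤ a) (hb : ¬ InBlock t b) :
    a ⇨ b = b := by
  by_contra h
  have hab : ¬ a ≤ b := fun hab => hb (le_antisymm hab hba ▸ ha)
  obtain ⟨s, hs, hbs⟩ := hW.exists_isCap_of_himp_ne hba hab h
  exact hb (ha.eq_of_isCap hs ▸ hbs)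

end WeakPeirceLaw

end WeakPeirceLaw

/-! ### Local finiteness -/

/-- The elements of a finite set that belong to the block of a node generate a finite relative
Boolean algebra, of size bounded in that of the finite set. -/
theorem WeakPeirceLaw.exists_finset_block (n : ℕ) : ∃ N : ℕ, ∀ {B : Type} [HeytingAlgebra B],
    WeakPeirceLaw B → ∀ {t : B} (G : Finset B), G.card ≤ n → (∃ a ∈ G, InBlock t a) →
    ∃ (m : B) (E : Finset B), E.card ≤ N ∧ InBlock t m ∧ t ∈ E ∧ (∀ a ∈ G, InBlock t a → a ∈ E) ∧
      (∀ a ∈ E, m ≤ a ∧ a ≤ t) ∧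
      ∀ a ∈ E, ∀ b ∈ E, a ⊓ b ∈ E ∧ a ⊔ b ∈ E ∧ (a ≤ b ∨ a ⇨ b ∈ E) := by
  classical
  obtain ⟨N, hN⟩ := exists_finset_relative_boolean n
  refine ⟨N, fun {B _} hW {t} G hG hne => ?_⟩
  set F := G.filter (InBlock t) with hF
  have hFne : F.Nonempty := by
    obtain ⟨a, ha, hta⟩ := hne
    exact ⟨a, Finset.mem_filter.2 ⟨ha, hta⟩⟩
  set m := F.inf' hFne id with hmdef
  have hm : InBlock t m :=
    Finset.inf'_induction hFne id (fun _ h₁ _ h₂ => h₁.inf h₂)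
      fun a ha => (Finset.mem_filter.1 ha).2
  obtain ⟨E, hE, hFE, -, ht, hcl, hc⟩ := hN hm.le F ((Finset.card_filter_le _ _).trans hG) (by
    intro x hx
    have hmx : m ≤ x := Finset.inf'_le id hx
    have hx := (Finset.mem_filter.1 hx).2
    -- The pseudocomplement of `x` in `[m, t]` is a true complement by `le_sup_himp_of_inBlock`.
    refine ⟨(x ⇨ m) ⊓ t, ?_, ?_⟩
    · rw [← inf_assoc, inf_himp, inf_eq_right.2 hmx, inf_eq_left.2 hm.le]
    · rw [sup_inf_left, sup_eq_right.2 hx.le, inf_eq_right]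
      exact hW.le_sup_himp_of_inBlock hx hm)
  have hmem : ∀ a ∈ E, m ≤ a ∧ a ≤ t := by
    intro a ha
    obtain ⟨w, -, h₁, h₂⟩ := hc a ha
    exact ⟨h₁ ▸ inf_le_left, h₂ ▸ le_sup_left⟩
  refine ⟨m, E, hE, hm, ht, fun a ha hta => hFE (Finset.mem_filter.2 ⟨ha, hta⟩), hmem, ?_⟩
  intro a ha b hb
  refine ⟨(hcl a ha b hb).1, (hcl a ha b hb).2, ?_⟩
  rcases hm.isNode (a ⇨ b) with h | h
  swap
  · exact Or.inl ((le_inf (hmem a ha).2 le_rfl).trans (le_himp_iff.1 h))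
  right
  obtain ⟨z, hz, h₁, h₂⟩ := hc a ha
  have : a ⇨ b = z ⊔ b := by
    refine le_antisymm ?_ (sup_le (le_himp_iff'.2 (h₁.le.trans (hmem b hb).1)) le_himp)
    rw [← inf_eq_left.2 h, ← h₂, inf_sup_left, sup_comm]
    exact sup_le_sup inf_le_right himp_inf_le
  rw [this]
  exact (hcl z hz b hb).2

/-- Heyting algebras with the weak Peirce law are locally finite, uniformly in the number of
generators. -/
theorem WeakPeirceLaw.exists_finset_closed (n : ℕ) : ∃ N : ℕ, ∀ {B : Type} [HeytingAlgebra B],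
    WeakPeirceLaw B → ∀ F : Finset B, F.card ≤ n →
    ∃ S : Finset B, S.card ≤ N ∧ F ⊆ S ∧ ⊥ ∈ S ∧ ⊤ ∈ S ∧
      ∀ a ∈ S, ∀ b ∈ S, a ⊓ b ∈ S ∧ a ⊔ b ∈ S ∧ a ⇨ b ∈ S := by
  classical
  obtain ⟨N, hN⟩ := WeakPeirceLaw.exists_finset_block ((n + n) + 2)
  refine ⟨((n + n) + 2) + ((n + n) + 2) * N, fun {B _} hW F hF => ?_⟩
  have hcap : ∀ x : B, ∃ t, IsNode t ∧ (¬ IsNode x → IsCap t x) := by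
    intro x
    by_cases hx : IsNode x
    · exact ⟨x, hx, fun h => absurd hx h⟩
    · obtain ⟨t, ht⟩ := hW.exists_isCap hx
      exact ⟨t, ht.2.1.1, fun _ => ht⟩
  choose cap hcap_node hcap using hcap
  -- Adding caps once suffices, since caps, `⊥` and `⊤` are nodes and have no caps.
  obtain ⟨G, hG, hFG, hbot, htop, hGcap⟩ : ∃ G : Finset B, G.card ≤ (n + n) + 2 ∧ F ⊆ G ∧
      ⊥ ∈ G ∧ ⊤ ∈ G ∧ ∀ x ∈ G, ∀ t, IsCap t x → t ∈ G := by
    refine ⟨(F ∪ F.image cap) ∪ {⊥, ⊤}, ?_, ?_, by simp, by simp, ?_⟩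
    · refine (Finset.card_union_le _ _).trans (add_le_add ?_ Finset.card_le_two)
      exact (Finset.card_union_le _ _).trans (add_le_add hF (Finset.card_image_le.trans hF))
    · exact Finset.subset_union_left.trans Finset.subset_union_left
    · intro x hx t ht
      have key : x ∈ F := by
        by_contra hxF
        simp only [Finset.mem_union, hxF, false_or, Finset.mem_insert, Finset.mem_singleton,
          Finset.mem_image] at hx
        refine ht.1 ?_
        rcases hx with ⟨y, -, rfl⟩ | rfl | rfl
        · exact hcap_node y
        · exact fun _ => Or.inr bot_le
        · exact fun _ => Or.inl le_top
      rw [ht.unique (hcap x ht.1)]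
      simp only [Finset.mem_union, Finset.mem_image]
      exact Or.inl (Or.inr ⟨x, key, rfl⟩)
  have hblock : ∀ t : B, ∃ (m : B) (E : Finset B), (∃ a ∈ G, InBlock t a) → E.card ≤ N ∧
      InBlock t m ∧ t ∈ E ∧ (∀ a ∈ G, InBlock t a → a ∈ E) ∧ (∀ a ∈ E, m ≤ a ∧ a ≤ t) ∧
      ∀ a ∈ E, ∀ b ∈ E, a ⊓ b ∈ E ∧ a ⊔ b ∈ E ∧ (a ≤ b ∨ a ⇨ b ∈ E) := by
    intro t
    by_cases h : ∃ a ∈ G, InBlock t a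
    · obtain ⟨m, E, h'⟩ := hN hW G hG h
      exact ⟨m, E, fun _ => h'⟩
    · exact ⟨t, ∅, fun h' => absurd h' h⟩
  choose m E hblock using hblock
  set T := G.filter fun t => ∃ a ∈ G, IsCap t a with hT
  have hTG : ∀ t ∈ T, t ∈ G := fun t ht => (Finset.mem_filter.1 ht).1
  have hTE : ∀ t ∈ T, (E t).card ≤ N ∧ InBlock t (m t) ∧ t ∈ E t ∧
      (∀ a ∈ G, InBlock t a → a ∈ E t) ∧ (∀ a ∈ E t, m t ≤ a ∧ a ≤ t) ∧
      ∀ a ∈ E t, ∀ b ∈ E t, a ⊓ b ∈ E t ∧ a ⊔ b ∈ E t ∧ (a ≤ b ∨ a ⇨ b ∈ E t) := by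
    intro t ht
    obtain ⟨-, a, ha, hta⟩ := Finset.mem_filter.1 ht
    exact hblock t ⟨a, ha, .of_isCap hta⟩
  set S := G.filter IsNode ∪ T.biUnion E with hS
  have memS : ∀ a, a ∈ S ↔ (a ∈ G ∧ IsNode a) ∨ ∃ t ∈ T, a ∈ E t := by
    intro a
    simp [hS]
  have htopS : ⊤ ∈ S := (memS _).2 (Or.inl ⟨htop, fun _ => Or.inl le_top⟩)
  -- Relative to a chosen block, every other element lies wholly above it, or below it and invisible
  -- to implications from it.
  have pos : ∀ t ∈ T, ∀ b ∈ S, b ∈ E t ∨ t ≤ b ∨ (b ≤ m t ∧ m t ⇨ b = b) := by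
    intro t ht b hb
    obtain ⟨-, hm, -, hGE, -, -⟩ := hTE t ht
    have low : ∀ b, b ≤ m t → (b ∈ E t ∨ ¬ InBlock t b) → b ∈ E t ∨ m t ⇨ b = b := by
      intro b hbm h
      exact h.imp id fun h => hW.himp_eq_of_not_inBlock hm hbm h
    have node : ∀ b ∈ G, IsNode b → b ∈ E t ∨ t ≤ b ∨ (b ≤ m t ∧ m t ⇨ b = b) := by
      intro b hbG hb
      by_cases htb : t ≤ b
      · exact Or.inr (Or.inl htb)
      by_cases hbt : InBlock t b
      · exact Or.inl (hGE b hbG hbt)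
      · have := hm.node_le hb htb
        exact Or.inr (Or.inr ⟨this, hW.himp_eq_of_not_inBlock hm this hbt⟩)
    rcases (memS b).1 hb with ⟨hbG, hb⟩ | ⟨s, hs, hbs⟩
    · exact node b hbG hb
    · obtain ⟨-, hms, -, -, hbd, -⟩ := hTE s hs
      by_cases hst : s ≤ t
      swap
      · exact Or.inr (Or.inl ((hms.node_le hm.isNode hst).trans (hbd b hbs).1))
      by_cases hts : t ≤ s
      · exact Or.inl (le_antisymm hst hts ▸ hbs)
      by_cases hbeq : s ≤ b
      · rw [le_antisymm (hbd b hbs).2 hbeq]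
        exact node s (hTG s hs) hms.isNode
      have hbm := (hbd b hbs).2.trans (hm.node_le hms.isNode hts)
      exact Or.inr (Or.inr ⟨hbm, hW.himp_eq_of_not_inBlock hm hbm fun h =>
        hbeq (h.node_le hms.isNode hts)⟩)
  have comparable : ∀ a ∈ S, ∀ b ∈ S, (a ≤ b ∨ b ≤ a) → a ⊓ b ∈ S ∧ a ⊔ b ∈ S := by
    rintro a ha b hb (h | h)
    · rw [inf_eq_left.2 h, sup_eq_right.2 h]
      exact ⟨ha, hb⟩
    · rw [inf_eq_right.2 h, sup_eq_left.2 h]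
      exact ⟨hb, ha⟩
  have le_himp_mem : ∀ a b : B, a ≤ b → a ⇨ b ∈ S := fun a b h => by
    rwa [himp_eq_top_iff.2 h]
  refine ⟨S, ?_, ?_, ?_, htopS, ?_⟩
  · refine (Finset.card_union_le _ _).trans (add_le_add ((Finset.card_filter_le _ _).trans hG) ?_)
    refine (Finset.card_biUnion_le_card_mul _ _ N fun t ht => (hTE t ht).1).trans ?_
    exact Nat.mul_le_mul_right _ ((Finset.card_filter_le _ _).trans hG)
  · intro x hx
    by_cases hxn : IsNode x
    · exact (memS x).2 (Or.inl ⟨hFG hx, hxn⟩)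
    · obtain ⟨t, ht⟩ := hW.exists_isCap hxn
      have htT : t ∈ T := Finset.mem_filter.2 ⟨hGcap x (hFG hx) t ht, x, hFG hx, ht⟩
      exact (memS x).2 (Or.inr ⟨t, htT, (hTE t htT).2.2.2.1 x (hFG hx) (.of_isCap ht)⟩)
  · exact (memS _).2 (Or.inl ⟨hbot, fun _ => Or.inr bot_le⟩)
  · intro a ha b hb
    rcases (memS a).1 ha with ⟨-, han⟩ | ⟨t, ht, hat⟩
    · refine and_assoc.1 ⟨comparable a ha b hb (han b).symm, ?_⟩
      by_cases hab : a ≤ b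
      · exact le_himp_mem a b hab
      · rwa [hW.himp_eq_of_isNode han ((han b).resolve_right hab) hab]
    · obtain ⟨-, hm, -, -, hbd, hcl⟩ := hTE t ht
      rcases pos t ht b hb with hbt | htb | ⟨hbm, hmb⟩
      · obtain ⟨h₁, h₂, h₃⟩ := hcl a hat b hbt
        have hES : ∀ c ∈ E t, c ∈ S := fun c hc => (memS c).2 (Or.inr ⟨t, ht, hc⟩)
        exact ⟨hES _ h₁, hES _ h₂, h₃.elim (le_himp_mem a b) (hES _)⟩
      · have hab := (hbd a hat).2.trans htb
        exact and_assoc.1 ⟨comparable a ha b hb (Or.inl hab), le_himp_mem a b hab⟩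
      · have hba := hbm.trans (hbd a hat).1
        refine and_assoc.1 ⟨comparable a ha b hb (Or.inr hba), ?_⟩
        rwa [le_antisymm ((himp_le_himp_right (hbd a hat).1).trans hmb.le) le_himp]

/-! ### Prime theories and Lindenbaum algebras -/

/-- A set of formulas that contains `IPC` and is closed under modus ponens. -/
structure PropTheory where
  carrier : Set Formula
  ipc_mem : ∀ {φ}, IPC φ → φ ∈ carrier
  mp : ∀ {φ ψ}, Formula.imp φ ψ ∈ carrier → φ ∈ carrier → ψ ∈ carrier

namespace PropTheory

variable (T : PropTheory) {φ ψ χ : Formula}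

theorem imp_of_mem (h : φ ∈ T.carrier) : Formula.imp ψ φ ∈ T.carrier :=
  T.mp (T.ipc_mem (.k _ _)) h

theorem imp_refl (φ : Formula) : Formula.imp φ φ ∈ T.carrier :=
  T.mp (T.mp (T.ipc_mem (.s φ (.imp φ φ) φ)) (T.ipc_mem (.k _ _))) (T.ipc_mem (.k _ _))

/-- The theory generated by a theory and one more formula. -/
def adjoin (χ : Formula) : PropTheory where
  carrier := {φ | Formula.imp χ φ ∈ T.carrier}
  ipc_mem h := T.imp_of_mem (T.ipc_mem h)
  mp h₁ h₂ := T.mp (T.mp (T.ipc_mem (.s _ _ _)) h₁) h₂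

theorem mem_adjoin_self : χ ∈ (T.adjoin χ).carrier := T.imp_refl χ

theorem mem_adjoin_of_mem (h : φ ∈ T.carrier) : φ ∈ (T.adjoin χ).carrier := T.imp_of_mem h

theorem imp_trans (h₁ : Formula.imp φ ψ ∈ T.carrier) (h₂ : Formula.imp ψ χ ∈ T.carrier) :
    Formula.imp φ χ ∈ T.carrier :=
  (T.adjoin φ).mp (T.mem_adjoin_of_mem h₂) h₁

theorem and_mem_iff : Formula.and φ ψ ∈ T.carrier ↔ φ ∈ T.carrier ∧ ψ ∈ T.carrier :=
  ⟨fun h => ⟨T.mp (T.ipc_mem (.and_left _ _)) h, T.mp (T.ipc_mem (.and_right _ _)) h⟩,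
    fun h => T.mp (T.mp (T.ipc_mem (.and_intro _ _)) h.1) h.2⟩

theorem or_imp (h₁ : Formula.imp φ χ ∈ T.carrier) (h₂ : Formula.imp ψ χ ∈ T.carrier) :
    Formula.imp (.or φ ψ) χ ∈ T.carrier :=
  T.mp (T.mp (T.ipc_mem (.or_elim _ _ _)) h₁) h₂

theorem imp_imp_iff : Formula.imp φ (.imp ψ χ) ∈ T.carrier ↔
    Formula.imp (.and φ ψ) χ ∈ T.carrier := by
  constructor
  · intro h
    have := ((T.adjoin (.and φ ψ)).and_mem_iff).1 (T.mem_adjoin_self)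
    exact (T.adjoin _).mp ((T.adjoin _).mp (T.mem_adjoin_of_mem h) this.1) this.2
  · intro h
    have h₁ : φ ∈ ((T.adjoin φ).adjoin ψ).carrier :=
      (T.adjoin φ).mem_adjoin_of_mem T.mem_adjoin_self
    have h₂ : ψ ∈ ((T.adjoin φ).adjoin ψ).carrier := (T.adjoin φ).mem_adjoin_self
    exact ((T.adjoin φ).adjoin ψ).mp
      ((T.adjoin φ).mem_adjoin_of_mem (T.mem_adjoin_of_mem h))
      ((PropTheory.and_mem_iff _).2 ⟨h₁, h₂⟩)

/-- Formulas, preordered by provable implication. -/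
def Preformula (_ : PropTheory) : Type := Formula

instance : Preorder T.Preformula where
  le φ ψ := Formula.imp φ ψ ∈ T.carrier
  le_refl := T.imp_refl
  le_trans _ _ _ := T.imp_trans

/-- The Lindenbaum algebra of a theory. -/
def Lindenbaum : Type := Antisymmetrization T.Preformula (· ≤ ·)

instance : PartialOrder T.Lindenbaum :=
  inferInstanceAs (PartialOrder (Antisymmetrization T.Preformula (· ≤ ·)))

/-- The class of a formula in the Lindenbaum algebra. -/
def toLindenbaum (φ : Formula) : T.Lindenbaum :=
  toAntisymmetrization (α := T.Preformula) (· ≤ ·) φ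

theorem toLindenbaum_le : T.toLindenbaum φ ≤ T.toLindenbaum ψ ↔ Formula.imp φ ψ ∈ T.carrier :=
  Iff.rfl

theorem toLindenbaum_surjective : Function.Surjective T.toLindenbaum :=
  Quotient.mk_surjective

theorem toLindenbaum_eq : T.toLindenbaum φ = T.toLindenbaum ψ ↔ Formula.iff φ ψ ∈ T.carrier := by
  rw [le_antisymm_iff, toLindenbaum_le, toLindenbaum_le, Formula.iff, and_mem_iff]

/-- A binary connective that respects provable equivalence, as an operation on the Lindenbaum
algebra. -/
def liftConnective (f : Formula → Formula → Formula)
    (hf : ∀ {φ φ' ψ ψ'}, Formula.imp φ φ' ∈ T.carrier → Formula.imp φ' φ ∈ T.carrier →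
      Formula.imp ψ ψ' ∈ T.carrier → Formula.imp ψ' ψ ∈ T.carrier →
      Formula.imp (f φ ψ) (f φ' ψ') ∈ T.carrier) :
    T.Lindenbaum → T.Lindenbaum → T.Lindenbaum :=
  Quotient.map₂ f fun _ _ h₁ _ _ h₂ => ⟨hf h₁.1 h₁.2 h₂.1 h₂.2, hf h₁.2 h₁.1 h₂.2 h₂.1⟩

theorem imp_and (h₁ : Formula.imp χ φ ∈ T.carrier) (h₂ : Formula.imp χ ψ ∈ T.carrier) :
    Formula.imp χ (.and φ ψ) ∈ T.carrier :=
  (T.adjoin χ).and_mem_iff.2 ⟨h₁, h₂⟩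

instance : HeytingAlgebra T.Lindenbaum where
  inf := T.liftConnective .and fun h₁ _ h₂ _ =>
    T.imp_and (T.imp_trans (T.ipc_mem (.and_left _ _)) h₁)
      (T.imp_trans (T.ipc_mem (.and_right _ _)) h₂)
  sup := T.liftConnective .or fun h₁ _ h₂ _ =>
    T.or_imp (T.imp_trans h₁ (T.ipc_mem (.or_left _ _)))
      (T.imp_trans h₂ (T.ipc_mem (.or_right _ _)))
  himp := T.liftConnective .imp fun _ h₁ h₂ _ =>
    T.imp_imp_iff.2 (T.imp_trans (T.imp_trans
      (T.imp_and (T.ipc_mem (.and_left _ _)) (T.imp_trans (T.ipc_mem (.and_right _ _)) h₁))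
      (T.imp_imp_iff.1 (T.imp_refl _))) h₂)
  top := T.toLindenbaum .top
  bot := T.toLindenbaum .bot
  compl a := T.liftConnective .imp (fun _ h₁ h₂ _ =>
    T.imp_imp_iff.2 (T.imp_trans (T.imp_trans
      (T.imp_and (T.ipc_mem (.and_left _ _)) (T.imp_trans (T.ipc_mem (.and_right _ _)) h₁))
      (T.imp_imp_iff.1 (T.imp_refl _))) h₂)) a (T.toLindenbaum .bot)
  le_sup_left := by
    rintro ⟨φ⟩ ⟨ψ⟩
    exact T.ipc_mem (.or_left φ ψ)
  le_sup_right := by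
    rintro ⟨φ⟩ ⟨ψ⟩
    exact T.ipc_mem (.or_right φ ψ)
  sup_le := by
    rintro ⟨φ⟩ ⟨ψ⟩ ⟨χ⟩ h₁ h₂
    exact T.or_imp h₁ h₂
  inf_le_left := by
    rintro ⟨φ⟩ ⟨ψ⟩
    exact T.ipc_mem (.and_left φ ψ)
  inf_le_right := by
    rintro ⟨φ⟩ ⟨ψ⟩
    exact T.ipc_mem (.and_right φ ψ)
  le_inf := by
    rintro ⟨φ⟩ ⟨ψ⟩ ⟨χ⟩ h₁ h₂
    exact T.imp_and h₁ h₂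
  le_top := by
    rintro ⟨φ⟩
    exact T.imp_of_mem (T.ipc_mem .top_intro)
  bot_le := by
    rintro ⟨φ⟩
    exact T.ipc_mem (.bot_elim φ)
  le_himp_iff := by
    rintro ⟨φ⟩ ⟨ψ⟩ ⟨χ⟩
    exact T.imp_imp_iff
  himp_bot _ := rfl

/-- A formula outside a superintuitionistic logic is omitted by some prime theory that contains
the logic. -/
theorem exists_prime_not_mem (L : SuperintuitionisticLogic) (h : ¬ L.Proves φ) :
    ∃ T : PropTheory, L.carrier ⊆ T.carrier ∧ φ ∉ T.carrier ∧
      ∀ ψ χ, Formula.or ψ χ ∈ T.carrier → ψ ∈ T.carrier ∨ χ ∈ T.carrier := by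
  obtain ⟨M, -, hM⟩ := zorn_subset_nonempty
    {Γ : Set Formula | L.carrier ⊆ Γ ∧ φ ∉ Γ ∧
      ∀ ψ χ, Formula.imp ψ χ ∈ Γ → ψ ∈ Γ → χ ∈ Γ} (by
      intro c hc hchain hne
      obtain ⟨Γ₀, hΓ₀⟩ := hne
      refine ⟨⋃₀ c, ⟨(hc hΓ₀).1.trans (Set.subset_sUnion_of_mem hΓ₀), ?_, ?_⟩,
        fun Γ hΓ => Set.subset_sUnion_of_mem hΓ⟩
      · rintro ⟨Γ, hΓ, hφ⟩
        exact (hc hΓ).2.1 hφ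
      · rintro ψ χ ⟨Γ, hΓ, h₁⟩ ⟨Δ, hΔ, h₂⟩
        rcases hchain.total hΓ hΔ with hle | hle
        · exact ⟨Δ, hΔ, (hc hΔ).2.2 ψ χ (hle h₁) h₂⟩
        · exact ⟨Γ, hΓ, (hc hΓ).2.2 ψ χ h₁ (hle h₂)⟩)
    L.carrier ⟨subset_rfl, h, L.mp_mem⟩
  obtain ⟨hLM, hφ, hmp⟩ := hM.prop
  let T : PropTheory := ⟨M, fun h => hLM (L.ipc_subset _ h), fun h₁ h₂ => hmp _ _ h₁ h₂⟩
  -- By maximality, adjoining `ψ` would make `φ` derivable.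
  have key : ∀ ψ, ψ ∉ T.carrier → Formula.imp ψ φ ∈ T.carrier := by
    intro ψ hψ
    by_contra hcon
    have hsub : M ⊆ (T.adjoin ψ).carrier := fun _ h => T.mem_adjoin_of_mem h
    have := hM.le_of_ge (y := (T.adjoin ψ).carrier)
      ⟨hLM.trans hsub, hcon, fun _ _ h₁ h₂ => (T.adjoin ψ).mp h₁ h₂⟩ hsub
    exact hψ (this T.mem_adjoin_self)
  refine ⟨T, hLM, hφ, fun ψ χ h => ?_⟩
  by_contra! hcon
  exact hφ (T.mp (T.or_imp (key ψ hcon.1) (key χ hcon.2)) h)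

/-- Primeness splits each instance of the axiom; the instances come from `wPL`, as `T` need not be
closed under substitution. -/
theorem weakPeirceLaw_lindenbaum (hT : SuperintuitionisticLogic.wPL.carrier ⊆ T.carrier)
    (hprime : ∀ ψ χ, Formula.or ψ χ ∈ T.carrier → ψ ∈ T.carrier ∨ χ ∈ T.carrier) :
    WeakPeirceLaw T.Lindenbaum := by
  intro a b
  obtain ⟨α, rfl⟩ := T.toLindenbaum_surjective a
  obtain ⟨β, rfl⟩ := T.toLindenbaum_surjective b
  have h : SuperintuitionisticLogic.weakPeirce ∈ SuperintuitionisticLogic.wPL.carrier :=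
    fun _ h => h
  exact hprime _ _ (hT (SuperintuitionisticLogic.wPL.subst_mem
    (fun i => if i = 0 then α else β) _ h))

end PropTheory

/-! ### Finite interpretations and local tabularity -/

/-- An algebra in the signature of propositional formulas, without any laws, together with values
for the variables. -/
structure Interpretation (ι X : Type) where
  and : X → X → X
  or : X → X → X
  imp : X → X → X
  bot : X
  top : X
  var : ι → X

namespace Interpretation

instance {ι X : Type} [Finite ι] [Finite X] : Finite (Interpretation ι X) :=
  Finite.of_injective
    (fun A : Interpretation ι X => (A.and, A.or, A.imp, A.bot, A.top, A.var)) (by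
      rintro ⟨⟩ ⟨⟩ h
      simpa using h)

/-- The value of a formula whose variables belong to the finite set `s`; the other variables are
treated as `⊥`. -/
def eval {s : Finset ℕ} {X : Type} (A : Interpretation s X) : Formula → X
  | .var i => if h : i ∈ s then A.var ⟨i, h⟩ else A.bot
  | .bot => A.bot
  | .top => A.top
  | .and φ ψ => A.and (A.eval φ) (A.eval ψ)
  | .or φ ψ => A.or (A.eval φ) (A.eval ψ)
  | .imp φ ψ => A.imp (A.eval φ) (A.eval ψ)

end Interpretation

/-- In the Lindenbaum algebra of a prime theory over `wPL`, the classes of the formulas in a given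
finite set of variables are computed in an algebra on a fixed finite set. -/
theorem exists_interpretation (s : Finset ℕ) : ∃ N : ℕ, ∀ T : PropTheory,
    WeakPeirceLaw T.Lindenbaum → ∃ (A : Interpretation s (Fin N)) (e : Fin N → T.Lindenbaum),
      ∀ φ : Formula, φ.vars ⊆ s → e (A.eval φ) = T.toLindenbaum φ := by
  classical
  obtain ⟨N, hN⟩ := WeakPeirceLaw.exists_finset_closed s.card
  refine ⟨N, fun T hW => ?_⟩
  obtain ⟨S, hS, hsS, hbot, htop, hcl⟩ := hN hW (s.image fun i => T.toLindenbaum (.var i))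
    Finset.card_image_le
  obtain ⟨f⟩ : Nonempty (S ↪ Fin N) := Function.Embedding.nonempty_of_card_le (by simpa using hS)
  have : Nonempty S := ⟨⟨⊥, hbot⟩⟩
  let e : Fin N → T.Lindenbaum := fun i => (Function.invFun f i : S)
  -- The value outside `S` is junk: closure of `S` keeps evaluation inside it.
  let g : T.Lindenbaum → Fin N := fun b => if h : b ∈ S then f ⟨b, h⟩ else f ⟨⊥, hbot⟩
  have he : ∀ i, e i ∈ S := fun i => (Function.invFun f i : S).2
  have heg : ∀ b ∈ S, e (g b) = b := by
    intro b hb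
    simp only [e, g, hb, dif_pos, Function.leftInverse_invFun f.injective _]
  let A : Interpretation s (Fin N) :=
    { and := fun i j => g (e i ⊓ e j)
      or := fun i j => g (e i ⊔ e j)
      imp := fun i j => g (e i ⇨ e j)
      bot := g ⊥
      top := g ⊤
      var := fun i => g (T.toLindenbaum (.var i)) }
  refine ⟨A, e, fun φ hφ => ?_⟩
  induction φ with
  | var i =>
    have hi : i ∈ s := by simpa [Formula.vars] using hφ
    simp only [Interpretation.eval, hi, dif_pos, A]
    exact heg _ (hsS (Finset.mem_image_of_mem _ hi))
  | bot => exact heg _ hbot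
  | top => exact heg _ htop
  | and φ ψ ih₁ ih₂ =>
    obtain ⟨h₁, h₂⟩ := Finset.union_subset_iff.1 hφ
    refine (heg _ (hcl _ (he _) _ (he _)).1).trans ?_
    rw [ih₁ h₁, ih₂ h₂]
    rfl
  | or φ ψ ih₁ ih₂ =>
    obtain ⟨h₁, h₂⟩ := Finset.union_subset_iff.1 hφ
    refine (heg _ (hcl _ (he _) _ (he _)).2.1).trans ?_
    rw [ih₁ h₁, ih₂ h₂]
    rfl
  | imp φ ψ ih₁ ih₂ =>
    obtain ⟨h₁, h₂⟩ := Finset.union_subset_iff.1 hφ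
    refine (heg _ (hcl _ (he _) _ (he _)).2.2).trans ?_
    rw [ih₁ h₁, ih₂ h₂]
    rfl

/-- Formulas with the same value under each of the finitely many interpretations are equivalent, as
otherwise a prime theory would omit their biconditional. -/
theorem locallyTabular_wPL : SuperintuitionisticLogic.wPL.LocallyTabular := by
  intro s
  obtain ⟨N, hN⟩ := exists_interpretation s
  let code : {φ : Formula // φ.vars ⊆ s} → Interpretation s (Fin N) → Fin N :=
    fun φ A => A.eval φ
  refine ⟨Set.range fun c : Set.range code => (c.2.choose : Formula), Set.finite_range _, ?_, ?_⟩
  · rintro _ ⟨c, rfl⟩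
    exact c.2.choose.2
  · intro φ hφ
    let c : Set.range code := ⟨code ⟨φ, hφ⟩, ⟨φ, hφ⟩, rfl⟩
    refine ⟨c.2.choose, ⟨c, rfl⟩, ?_⟩
    have hc : code c.2.choose = code ⟨φ, hφ⟩ := c.2.choose_spec
    by_contra hcon
    obtain ⟨T, hT, hmem, hprime⟩ := PropTheory.exists_prime_not_mem _ hcon
    obtain ⟨A, e, he⟩ := hN T (T.weakPeirceLaw_lindenbaum hT hprime)
    refine hmem (T.toLindenbaum_eq.1 ?_)
    rw [← he φ hφ, ← he _ c.2.choose.2]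
    exact congrArg e (congrFun hc A).symm

theorem mainTheorem1 :
    SuperintuitionisticLogic.wPL.LocallyTabular ∧
      ¬ SuperintuitionisticLogic.wPL.UniformlyLocallyTabular :=
  ⟨locallyTabular_wPL, fun ⟨n, hn⟩ => not_uniform_wPL n hn⟩
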